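/- Let $p$ be a prime and let $d>1$ be a power of $p$. For $t\in\overline{\mathbb{Q}}$ let $f_t(z)=z^d+t$, and let $f_t^m$ denote its $m$-th iterate. Fix an embedding $\overline{\mathbb{Q}}\hookrightarrow\overline{\mathbb{Q}_p}$, and let $a,b\in\overline{\mathbb{Q}}\cap\mathbb{Q}_p$ be such that one of $a,b$ is a $p$-adic unit (an element of $\mathbb{Z}_p^\times$) while the other one lies in $p\,\mathbb{Z}_p$. Then the set $$\{t\in\overline{\mathbb{Q}} : \text{there exist integers } m,n\ge 1 \text{ such that } f_t^m(a)=f_t^n(b)\}$$ has bounded height, i.e. the absolute logarithmic Weil height is bounded on this set. -/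

import Mathlib

/-! ### Roots of unity of prime power order -/

theorem one_sub_dvd_prime_of_pow_prime_pow_eq_one {R : Type*} [CommRing R] [IsDomain R]
    {p : ℕ} [hp : Fact p.Prime] {j : ℕ} {ζ : R} (h : ζ ^ p ^ j = 1) (h1 : ζ ≠ 1) :
    1 - ζ ∣ (p : R) := by
  obtain ⟨i, -, hi⟩ := (Nat.dvd_prime_pow hp.out).1 (orderOf_dvd_of_pow_eq_one h)
  obtain _ | i := i
  · exact absurd (orderOf_eq_one_iff.1 (by simpa using hi)) h1
  have hroot := (hi ▸ IsPrimitiveRoot.orderOf ζ).isRoot_cyclotomic (by positivity [hp.out.pos])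
  simpa [hroot.eq_zero] using (Polynomial.cyclotomic (p ^ (i + 1)) R).sub_dvd_eval_sub 1 ζ

/-! ### Collisions in a nonarchimedean field -/

section Ultrametric

variable {E : Type*} [NormedField E] [IsUltrametricDist E] {p : ℕ} [hp : Fact p.Prime]

theorem norm_add_eq_left_of_lt {x y : E} (h : ‖y‖ < ‖x‖) : ‖x + y‖ = ‖x‖ := by
  rw [IsUltrametricDist.norm_add_eq_max_of_norm_ne_norm h.ne', max_eq_left h.le]

theorem norm_add_pow_prime_pow_sub_le (j : ℕ) {x y : E} (hx : ‖x‖ ≤ 1) (hy : ‖y‖ ≤ 1) :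
    ‖(x + y) ^ p ^ j - x ^ p ^ j - y ^ p ^ j‖ ≤ ‖(p : E)‖ * ‖x‖ := by
  let O := (NormedField.valuation (K := E)).integer
  have hmem : ∀ {z : E}, z ∈ O ↔ ‖z‖ ≤ 1 := by
    intro z
    simp [O, Valuation.mem_integer_iff, NormedField.valuation_apply, ← NNReal.coe_le_coe]
  obtain ⟨r, hr⟩ := exists_add_pow_prime_pow_eq hp.out (⟨x, hmem.2 hx⟩ : O) ⟨y, hmem.2 hy⟩ j
  have hr' := congrArg (Subtype.val) hr
  push_cast at hr'
  rw [hr', show x ^ p ^ j + y ^ p ^ j + p * x * y * (r : E) - x ^ p ^ j - y ^ p ^ j =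
    p * x * (y * r) by ring, norm_mul, norm_mul]
  refine mul_le_of_le_one_right (by positivity) ?_
  rw [norm_mul]
  exact mul_le_one₀ hy (norm_nonneg _) (hmem.1 r.2)

theorem norm_prime_le_norm_one_sub {j : ℕ} {ζ : E} (h : ζ ^ p ^ j = 1) (h1 : ζ ≠ 1) :
    ‖(p : E)‖ ≤ ‖ζ - 1‖ := by
  let O := (NormedField.valuation (K := E)).integer
  have hmem : ∀ {z : E}, z ∈ O ↔ ‖z‖ ≤ 1 := by
    intro z
    simp [O, Valuation.mem_integer_iff, NormedField.valuation_apply, ← NNReal.coe_le_coe]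
  have hζ : ‖ζ‖ = 1 := by
    have : ‖ζ‖ ^ p ^ j = 1 := by rw [← norm_pow, h, norm_one]
    exact (pow_eq_one_iff_of_nonneg (norm_nonneg _) (by positivity [hp.out.pos])).1 this
  obtain ⟨r, hr⟩ := one_sub_dvd_prime_of_pow_prime_pow_eq_one (R := O) (p := p) (j := j)
    (ζ := ⟨ζ, hmem.2 hζ.le⟩) (Subtype.ext (by simpa using h)) (fun h' ↦ h1 (by simpa using congrArg Subtype.val h'))
  have hr' := congrArg Subtype.val hr
  push_cast at hr'
  rw [hr', norm_mul, norm_sub_rev]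
  exact mul_le_of_le_one_right (norm_nonneg _) (hmem.1 r.2)

theorem norm_pow_sub_one_lt_one (hp1 : ‖(p : E)‖ < 1) (j : ℕ) {u : E} (hu : ‖u - 1‖ < 1) :
    ‖u ^ p ^ j - 1‖ < 1 := by
  have h := norm_add_pow_prime_pow_sub_le (p := p) j hu.le (norm_one (α := E)).le
  rw [sub_add_cancel, one_pow] at h
  rw [show u ^ p ^ j - 1 = (u ^ p ^ j - (u - 1) ^ p ^ j - 1) + (u - 1) ^ p ^ j by ring]
  refine (IsUltrametricDist.norm_add_le_max _ _).trans_lt (max_lt (h.trans_lt ?_) ?_)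
  · exact mul_lt_one_of_nonneg_of_lt_one_left (norm_nonneg _) hp1 hu.le
  · rw [norm_pow]
    exact pow_lt_one₀ (norm_nonneg _) hu (by positivity [hp.out.pos])

theorem norm_pow_sub_one_eq (hp0 : 0 < ‖(p : E)‖) (j : ℕ) {u : E}
    (hu : ‖u - 1‖ < 1) (hlarge : ‖(p : E)‖ ≤ ‖u ^ p ^ j - 1‖) :
    ‖u ^ p ^ j - 1‖ = ‖u - 1‖ ^ p ^ j := by
  have h := norm_add_pow_prime_pow_sub_le (p := p) j hu.le (norm_one (α := E)).le
  rw [sub_add_cancel, one_pow] at h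
  have h' : ‖u ^ p ^ j - (u - 1) ^ p ^ j - 1‖ < ‖u ^ p ^ j - 1‖ :=
    h.trans_lt ((mul_lt_of_lt_one_right hp0 hu).trans_le hlarge)
  rw [← norm_pow, ← norm_add_eq_left_of_lt (x := u ^ p ^ j - 1)
    (y := -(u ^ p ^ j - (u - 1) ^ p ^ j - 1)) (by rwa [norm_neg])]
  congr 1
  ring

variable {k₀ : ℕ} {τ : E} {X Y : ℕ → E}

theorem norm_orbit_sub_eq_one (hp1 : ‖(p : E)‖ < 1) (hτ : ‖τ‖ ≤ 1)
    (hX : ∀ k, X (k + 1) = X k ^ p ^ k₀ + τ) (hY : ∀ k, Y (k + 1) = Y k ^ p ^ k₀ + τ)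
    (hX0 : ‖X 0‖ ≤ 1) (hY0 : ‖Y 0‖ ≤ 1) (h0 : ‖X 0 - Y 0‖ = 1) (k : ℕ) :
    ‖X k‖ ≤ 1 ∧ ‖Y k‖ ≤ 1 ∧ ‖X k - Y k‖ = 1 := by
  induction k with
  | zero => exact ⟨hX0, hY0, h0⟩
  | succ k ih =>
    obtain ⟨ih1, ih2, ih3⟩ := ih
    have aux : ∀ {z : E}, ‖z‖ ≤ 1 → ‖z ^ p ^ k₀ + τ‖ ≤ 1 := fun {z} hz ↦
      (IsUltrametricDist.norm_add_le_max _ _).trans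
        (max_le (by rw [norm_pow]; exact pow_le_one₀ (norm_nonneg _) hz) hτ)
    refine ⟨hX k ▸ aux ih1, hY k ▸ aux ih2, ?_⟩
    have h := norm_add_pow_prime_pow_sub_le (p := p) k₀ ih3.le ih2
    rw [sub_add_cancel, ih3, mul_one] at h
    have e : ‖(X k - Y k) ^ p ^ k₀‖ = 1 := by rw [norm_pow, ih3, one_pow]
    rw [hX, hY, ← e, ← norm_add_eq_left_of_lt (h.trans_lt (hp1.trans_eq e.symm))]
    congr 1
    ring

theorem norm_orbit_eq_pow {d : ℕ} (hd : 1 < d) (hτ : 1 < ‖τ‖)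
    (hX : ∀ k, X (k + 1) = X k ^ d + τ) (hX0 : ‖X 0‖ ≤ 1) (k : ℕ) :
    ‖X (k + 1)‖ = ‖τ‖ ^ d ^ k := by
  induction k with
  | zero =>
    rw [hX, add_comm, norm_add_eq_left_of_lt]
    · simp
    · rw [norm_pow]
      exact (pow_le_one₀ (norm_nonneg _) hX0).trans_lt hτ
  | succ k ih =>
    have e : ‖X (k + 1) ^ d‖ = ‖τ‖ ^ d ^ (k + 1) := by rw [norm_pow, ih, ← pow_mul, pow_succ]
    rw [hX, ← e, norm_add_eq_left_of_lt]
    rw [e]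
    exact lt_self_pow₀ hτ (Nat.one_lt_pow (by lia) hd)

theorem pow_eq_of_le_of_forall_eq_pow {e : ℕ → ℝ} {c : ℝ} {d : ℕ} (hd : d ≠ 0)
    (h0 : ∀ i, 0 ≤ e i) (h1 : ∀ i, e i < 1) (h : ∀ i, c ≤ e (i + 1) → e (i + 1) = e i ^ d) (k : ℕ)
    (hk : c ≤ e k) : e 0 ^ d ^ k = e k := by
  induction k with
  | zero => simp
  | succ k ih =>
    have := h k hk
    rw [this] at hk ⊢
    rw [pow_succ, pow_mul, ih (hk.trans (pow_le_of_le_one (h0 k) (h1 k).le hd))]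

/-- If the orbits of two points in distinct residue classes first collide at time `k + 2`, then
the parameter is large, but not too large. -/
theorem norm_parameter_of_collision (hp0 : 0 < ‖(p : E)‖) (hp1 : ‖(p : E)‖ < 1) (hk₀ : k₀ ≠ 0)
    (hX : ∀ k, X (k + 1) = X k ^ p ^ k₀ + τ) (hY : ∀ k, Y (k + 1) = Y k ^ p ^ k₀ + τ)
    (hX0 : ‖X 0‖ ≤ 1) (hY0 : ‖Y 0‖ ≤ 1) (h0 : ‖X 0 - Y 0‖ = 1) (k : ℕ)
    (hne : X (k + 1) ≠ Y (k + 1)) (heq : X (k + 2) = Y (k + 2)) :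
    1 < ‖τ‖ ∧ ‖(p : E)‖ * ‖τ‖ ^ (p ^ k₀) ^ k ≤ 1 := by
  have hd : 1 < p ^ k₀ := Nat.one_lt_pow hk₀ hp.out.one_lt
  have hτ : 1 < ‖τ‖ := by
    by_contra! hτ
    have := (norm_orbit_sub_eq_one hp1 hτ hX hY hX0 hY0 h0 (k + 2)).2.2
    simp [heq] at this
  refine ⟨hτ, ?_⟩
  have hYn := norm_orbit_eq_pow hd hτ hY hY0
  have hY0' : ∀ i, Y (i + 1) ≠ 0 := fun i ↦ by
    rw [← norm_pos_iff, hYn]; positivity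
  have step : ∀ i, ‖X (i + 2) / Y (i + 2) - 1‖ = ‖(X (i + 1) / Y (i + 1)) ^ p ^ k₀ - 1‖ := by
    intro i
    have e : ‖Y (i + 2)‖ = ‖Y (i + 1) ^ p ^ k₀‖ := by
      rw [hYn (i + 1), norm_pow, hYn i, pow_succ (p ^ k₀) i, pow_mul]
    rw [div_sub_one (hY0' (i + 1)), div_pow, div_sub_one (pow_ne_zero _ (hY0' i)), norm_div,
      norm_div, e, hX (i + 1), hY (i + 1), add_sub_add_right_eq_sub]
  have e0 : ‖X 1 / Y 1 - 1‖ = ‖τ‖⁻¹ := by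
    have h := norm_add_pow_prime_pow_sub_le (p := p) k₀ h0.le hY0
    rw [sub_add_cancel, h0, mul_one] at h
    have e : ‖(X 0 - Y 0) ^ p ^ k₀‖ = 1 := by rw [norm_pow, h0, one_pow]
    have : ‖X 1 - Y 1‖ = 1 := by
      rw [hX, hY, ← e, ← norm_add_eq_left_of_lt (h.trans_lt (hp1.trans_eq e.symm))]
      congr 1
      ring
    rw [div_sub_one (hY0' 0), norm_div, this, hYn 0]
    simp
  have hlt : ∀ i, ‖X (i + 1) / Y (i + 1) - 1‖ < 1 := by
    intro i
    induction i with
    | zero => rw [e0]; exact inv_lt_one_of_one_lt₀ hτ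
    | succ i ih => rw [step]; exact norm_pow_sub_one_lt_one hp1 _ ih
  have hζ : ‖(p : E)‖ ≤ ‖X (k + 1) / Y (k + 1) - 1‖ := by
    apply norm_prime_le_norm_one_sub (j := k₀)
    · rw [hX, hY] at heq
      rw [div_pow, add_right_cancel heq, div_self (pow_ne_zero _ (hY0' _))]
    · rwa [Ne, div_eq_one_iff_eq (hY0' _)]
  have key := pow_eq_of_le_of_forall_eq_pow (e := fun i ↦ ‖X (i + 1) / Y (i + 1) - 1‖)
    (c := ‖(p : E)‖) (d := p ^ k₀) (by lia) (fun i ↦ norm_nonneg _) hlt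
    (fun i hi ↦ by
      simp only [step] at hi ⊢
      exact norm_pow_sub_one_eq hp0 _ (hlt i) hi) k hζ
  simp only [zero_add, e0] at key
  rw [← key, inv_pow] at hζ
  rwa [← le_div_iff₀ (by positivity), one_div]

end Ultrametric

/-! ### Degrees over the `p`-adic numbers -/

theorem le_natDegree_minpoly_padic {p : ℕ} [hp : Fact p.Prime] {τ : PadicAlgCl p} {N : ℕ}
    (h1 : 1 < ‖τ‖) (h : ‖(p : PadicAlgCl p)‖ * ‖τ‖ ^ N ≤ 1) :
    N ≤ (minpoly ℚ_[p] τ).natDegree := by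
  have hint : IsIntegral ℚ_[p] τ := Algebra.IsIntegral.isIntegral τ
  set D := (minpoly ℚ_[p] τ).natDegree
  have hD : 0 < D := minpoly.natDegree_pos hint
  have hp0 : (0 : ℝ) < p := by exact_mod_cast hp.out.pos
  have hpn : ‖(p : PadicAlgCl p)‖ = (p : ℝ)⁻¹ := by
    rw [← map_natCast (algebraMap ℚ_[p] (PadicAlgCl p)), PadicAlgCl.norm_extends, Padic.norm_p]
  have hc : ‖τ‖ ^ D = ‖(minpoly ℚ_[p] τ).coeff 0‖ := by
    rw [← PadicAlgCl.spectralNorm_eq, spectralNorm.spectralNorm_eq_norm_coeff_zero_rpow,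
      ← Real.rpow_natCast, ← Real.rpow_mul (norm_nonneg _),
      one_div_mul_cancel (by exact_mod_cast hD.ne'), Real.rpow_one]
  have hgt : 1 < ‖(minpoly ℚ_[p] τ).coeff 0‖ := hc ▸ one_lt_pow₀ h1 hD.ne'
  have hge : (p : ℝ) ≤ ‖(minpoly ℚ_[p] τ).coeff 0‖ := by
    by_contra! hlt
    have := (Padic.norm_le_pow_iff_norm_lt_pow_add_one ((minpoly ℚ_[p] τ).coeff 0) 0).2
      (by simpa using hlt)
    simp at this
    linarith
  rw [hpn, inv_mul_le_iff₀ hp0, mul_one] at h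
  exact (pow_le_pow_iff_right₀ h1).1 (h.trans (hge.trans hc.ge))

theorem le_natDegree_minpoly_rat {p : ℕ} [hp : Fact p.Prime] {F : Type*} [Field F] [CharZero F]
    (σ : F →+* PadicAlgCl p) {t : F} (ht : IsIntegral ℚ t) {N : ℕ} (h1 : 1 < ‖σ t‖) (h : ‖(p : PadicAlgCl p)‖ * ‖σ t‖ ^ N ≤ 1) :
    N ≤ (minpoly ℚ t).natDegree := by
  have hmonic : (minpoly ℚ t).Monic := minpoly.monic ht
  refine (le_natDegree_minpoly_padic h1 h).trans ?_
  rw [← hmonic.natDegree_map (algebraMap ℚ ℚ_[p])]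
  refine Polynomial.natDegree_le_of_dvd (minpoly.dvd _ _ ?_) (hmonic.map _).ne_zero
  rw [Polynomial.aeval_map_algebraMap, Polynomial.aeval_def,
    show algebraMap ℚ (PadicAlgCl p) = σ.comp (algebraMap ℚ F) from
      RingHom.ext_rat _ _, ← Polynomial.hom_eval₂, ← Polynomial.aeval_def, minpoly.aeval, map_zero]

/-! ### Height bounds from denominators and conjugates -/

namespace NumberField

open Height

theorem prod_infinitePlace_pow_mult_eq_prod_embeddings {K : Type*} [Field K] [NumberField K]
    (g : ℝ → ℝ) (x : K) :
    ∏ v : InfinitePlace K, g (v x) ^ v.mult = ∏ φ : K →+* ℂ, g ‖φ x‖ := by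
  classical
  rw [← Finset.prod_fiberwise Finset.univ InfinitePlace.mk (fun φ : K →+* ℂ ↦ g ‖φ x‖)]
  refine Finset.prod_congr rfl fun w _ ↦ ?_
  have (φ : K →+* ℂ) (hφ : φ ∈ ({φ | InfinitePlace.mk φ = w} : Finset _)) :
      g ‖φ x‖ = g (w x) := by rw [← (Finset.mem_filter.mp hφ).2, InfinitePlace.apply]
  rw [Finset.prod_congr rfl this, Finset.prod_const, InfinitePlace.card_filter_mk_eq]

theorem mulHeight₁_le_of_isIntegral_natCast_mul {K : Type*} [Field K] [NumberField K] {x : K}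
    {M : ℕ} (hM : M ≠ 0) (hint : IsIntegral ℤ ((M : K) * x)) :
    mulHeight₁ x ≤ (M : ℝ) ^ Module.finrank ℚ K * ∏ φ : K →+* ℂ, max ‖φ x‖ 1 := by
  obtain ⟨y, hy⟩ : ∃ y : 𝓞 K, (y : K) = M * x := ⟨⟨_, hint⟩, rfl⟩
  have hMK : (M : K) ≠ 0 := mod_cast hM
  have hne : (![y, (M : 𝓞 K)] : Fin 2 → 𝓞 K) ≠ 0 := by simp [hM]
  have hv (i : Fin 2) : (![(y : K), (M : K)] i : K) = ((![y, (M : 𝓞 K)] i : 𝓞 K) : K) := by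
    fin_cases i <;> simp
  rw [← mul_div_cancel_left₀ x hMK, ← hy, mulHeight₁_div_eq_mulHeight,
    mulHeight_eq (by simp [hM]), hy, mul_div_cancel_left₀ x hMK]
  have hfin : ∏ᶠ v : FinitePlace K, ⨆ i, v (![(y : K), (M : K)] i) ≤ 1 := by
    have h := absNorm_mul_finprod_finitePlace_eq_one hne
    simp_rw [← hv] at h
    have hnn : 0 ≤ ∏ᶠ v : FinitePlace K, ⨆ i, v (![(y : K), (M : K)] i) :=
      finprod_nonneg fun v ↦ Real.iSup_nonneg_of_nonnegHomClass ..
    have h1 : (1 : ℝ) ≤ (Ideal.span (Set.range ![y, (M : 𝓞 K)])).absNorm := by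
      rw [Nat.one_le_cast, Nat.one_le_iff_ne_zero]
      intro h0
      rw [h0, Nat.cast_zero, zero_mul] at h
      exact zero_ne_one h
    nlinarith
  rw [hy] at hfin
  refine (mul_le_of_le_one_right (Finset.prod_nonneg fun v _ ↦
    pow_nonneg (Real.iSup_nonneg_of_nonnegHomClass ..) _) hfin).trans ?_
  rw [← prod_infinitePlace_pow_mult_eq_prod_embeddings (fun r ↦ max r 1),
    ← InfinitePlace.sum_mult_eq, ← Finset.prod_pow_eq_pow_sum, ← Finset.prod_mul_distrib]
  refine Finset.prod_le_prod (fun v _ ↦ pow_nonneg (Real.iSup_nonneg_of_nonnegHomClass ..) _)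
    fun v _ ↦ ?_
  rw [← mul_pow]
  refine pow_le_pow_left₀ (Real.iSup_nonneg_of_nonnegHomClass ..) (ciSup_le fun i ↦ ?_) _
  have hvM : v (M : K) = M := by simp
  fin_cases i
  · simp [hvM]
    gcongr
    exact le_max_left ..
  · simp only [Fin.mk_one, Matrix.cons_val_one, Matrix.cons_val_fin_one, hvM]
    exact le_mul_of_one_le_right (by positivity) (le_max_right ..)

open IntermediateField in
theorem absLogHeight₁_le_of_isIntegral_natCast_mul {F : Type*} [Field F] [CharZero F] {t : F}
    (ht : IsIntegral ℚ t) {M : ℕ} (hM : M ≠ 0) (hint : IsIntegral ℤ ((M : F) * t)) {B : ℝ}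
    (hB : ∀ s : Finset (ℚ⟮t⟯ →+* ℂ),
      ∏ φ ∈ s, max ‖φ (AdjoinSimple.gen ℚ t)‖ 1 ≤ B ^ (minpoly ℚ t).natDegree) (hB0 : 0 < B) :
    absLogHeight₁ t ≤ Real.log (M * B) := by
  classical
  have : FiniteDimensional ℚ ℚ⟮t⟯ := adjoin.finiteDimensional ht
  have : NumberField ℚ⟮t⟯ := {}
  have hM0 : (0 : ℝ) < M := by positivity
  have hint' : IsIntegral ℤ ((M : ℚ⟮t⟯) * AdjoinSimple.gen ℚ t) := by
    rw [← isIntegral_algebraMap_iff (algebraMap ℚ⟮t⟯ F).injective]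
    simpa using hint
  have h := (mulHeight₁_le_of_isIntegral_natCast_mul hM hint').trans
    (mul_le_mul_of_nonneg_left (hB Finset.univ) (by positivity))
  rw [← adjoin.finrank ht, ← mul_pow] at h
  have hpos : (0 : ℝ) < Module.finrank ℚ ℚ⟮t⟯ := by exact_mod_cast Module.finrank_pos
  rw [absLogHeight₁, absMulHeight₁, dif_pos ht]
  refine Real.log_le_log (Real.rpow_pos_of_pos (mulHeight₁_pos _) _) ?_
  rw [Real.rpow_inv_le_iff_of_pos (mulHeight₁_nonneg _) (by positivity) hpos, Real.rpow_natCast]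
  exact h

end NumberField

/-! ### Orbits as polynomials in the parameter -/

section OrbitPoly

open Polynomial

variable {R : Type*} [CommRing R] (d : ℕ)

/-- The polynomial whose value at `A ^ d * t` is `A ^ d ^ k * f^[k] (c / A)` where
`f z = z ^ d + t`. -/
noncomputable def scaledOrbitPoly (A c : R) : ℕ → R[X]
  | 0 => C c
  | k + 1 => scaledOrbitPoly A c k ^ d + C (A ^ (d ^ (k + 1) - d)) * X

variable {d}

theorem scaledOrbitPoly_monic_and_natDegree [Nontrivial R] (hd : 1 < d) (A c : R) (k : ℕ) :
    (scaledOrbitPoly d A c (k + 1)).Monic ∧ (scaledOrbitPoly d A c (k + 1)).natDegree = d ^ k := by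
  induction k with
  | zero =>
    have e : scaledOrbitPoly d A c 1 = X + C (c ^ d) := by
      simp [scaledOrbitPoly, add_comm]
    rw [zero_add, e, pow_zero]
    exact ⟨monic_X_add_C _, natDegree_X_add_C _⟩
  | succ k ih =>
    have hm := ih.1.pow d
    have hdeg : (scaledOrbitPoly d A c (k + 1) ^ d).natDegree = d ^ (k + 1) := by
      rw [ih.1.natDegree_pow, ih.2, pow_succ, mul_comm]
    have hlt : (C (A ^ (d ^ (k + 2) - d)) * X).degree < (scaledOrbitPoly d A c (k + 1) ^ d).degree := by
      rw [degree_eq_natDegree hm.ne_zero, hdeg]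
      refine (degree_C_mul_X_le _).trans_lt ?_
      exact_mod_cast Nat.one_lt_pow (by lia) hd
    exact ⟨hm.add_of_left hlt, by
      rw [scaledOrbitPoly, natDegree_add_eq_left_of_degree_lt hlt, hdeg]⟩

theorem aeval_scaledOrbitPoly {F : Type*} [Field F] [Algebra R F] {A c : R} {a t : F}
    (hc : algebraMap R F c = algebraMap R F A * a) (k : ℕ) :
    aeval (algebraMap R F A ^ d * t) (scaledOrbitPoly d A c k) =
      algebraMap R F A ^ d ^ k * (fun z ↦ z ^ d + t)^[k] a := by
  induction k with
  | zero => simp [scaledOrbitPoly, hc]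
  | succ k ih =>
    rw [scaledOrbitPoly, map_add, map_pow, ih, Function.iterate_succ_apply', mul_pow, ← pow_mul,
      ← pow_succ, map_mul, aeval_C, aeval_X, map_pow, ← mul_assoc, ← pow_add,
      Nat.sub_add_cancel (Nat.le_self_pow k.succ_ne_zero d), mul_add]

theorem leadingCoeff_sub_C_mul_of_monic {P Q : R[X]} (hP : P.Monic) (hQ : Q.Monic)
    (hdeg : P.natDegree = Q.natDegree) {ζ : R} (hζ : ζ ≠ 1) :
    (P - C ζ * Q).leadingCoeff = 1 - ζ := by
  have hc : (P - C ζ * Q).coeff P.natDegree = 1 - ζ := by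
    rw [coeff_sub, coeff_C_mul, hP.coeff_natDegree, hdeg, hQ.coeff_natDegree, mul_one]
  have hle : (P - C ζ * Q).natDegree ≤ P.natDegree :=
    (natDegree_sub_le _ _).trans (max_le le_rfl ((natDegree_C_mul_le _ _).trans hdeg.ge))
  rw [leadingCoeff, natDegree_eq_of_le_of_coeff_ne_zero hle (hc ▸ sub_ne_zero.2 hζ.symm), hc]

end OrbitPoly

/-! ### Denominators of collision parameters -/

section Integrality

open Polynomial

variable {F : Type*} [Field F] {d A : ℕ} {a b t : F}

theorem isIntegral_parameter_of_lt (hd : 1 < d) (ha : IsIntegral ℤ ((A : F) * a))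
    (hb : IsIntegral ℤ ((A : F) * b)) {m n : ℕ} (hnm : n < m)
    (h : (fun z : F ↦ z ^ d + t)^[m + 1] a = (fun z : F ↦ z ^ d + t)^[n + 1] b) :
    IsIntegral ℤ ((A : F) ^ d * t) := by
  let R := integralClosure ℤ F
  let a' : R := ⟨_, ha⟩
  let b' : R := ⟨_, hb⟩
  have hP := scaledOrbitPoly_monic_and_natDegree hd (A : R) a' m
  have hQ := scaledOrbitPoly_monic_and_natDegree hd (A : R) b' n
  have hle : d ^ (n + 1) ≤ d ^ (m + 1) := Nat.pow_le_pow_right (by lia) (by lia)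
  set P := scaledOrbitPoly d (A : R) a' (m + 1)
  set Q := scaledOrbitPoly d (A : R) b' (n + 1)
  have hPe := aeval_scaledOrbitPoly (F := F) (d := d) (A := (A : R)) (c := a') (a := a)
    (t := t) (by simp [a']) (m + 1)
  have hQe := aeval_scaledOrbitPoly (F := F) (d := d) (A := (A : R)) (c := b') (a := b)
    (t := t) (by simp [b']) (n + 1)
  rw [map_natCast] at hPe hQe
  have hmonic : (P - C ((A : R) ^ (d ^ (m + 1) - d ^ (n + 1))) * Q).Monic := by
    refine hP.1.sub_of_left ?_
    refine degree_le_natDegree.trans_lt ?_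
    rw [degree_eq_natDegree hP.1.ne_zero, Nat.cast_lt, hP.2]
    exact (natDegree_C_mul_le _ _).trans_lt (hQ.2 ▸ Nat.pow_lt_pow_right hd hnm)
  refine isIntegral_trans (A := R) _ ⟨_, hmonic, ?_⟩
  rw [← aeval_def, map_sub, map_mul, aeval_C, map_pow, map_natCast, hPe, hQe, h, ← mul_assoc,
    ← pow_add, Nat.sub_add_cancel hle, sub_self]

theorem isIntegral_parameter_of_root_of_unity {p : ℕ} [hp : Fact p.Prime] {k₀ : ℕ} (hd : 1 < d)
    (hdp : d = p ^ k₀) (ha : IsIntegral ℤ ((A : F) * a)) (hb : IsIntegral ℤ ((A : F) * b))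
    {ζ : F} (hζ : ζ ^ d = 1) (hζ1 : ζ ≠ 1) {k : ℕ}
    (h : (fun z : F ↦ z ^ d + t)^[k + 1] a = ζ * (fun z : F ↦ z ^ d + t)^[k + 1] b) :
    IsIntegral ℤ ((p : F) * ((A : F) ^ d * t)) := by
  let R := integralClosure ℤ F
  let a' : R := ⟨_, ha⟩
  let b' : R := ⟨_, hb⟩
  let ζ' : R := ⟨ζ, IsIntegral.of_pow (by lia : 0 < d) (hζ ▸ isIntegral_one)⟩
  have hζ1' : ζ' ≠ 1 := fun h ↦ hζ1 (congrArg Subtype.val h)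
  have hP := scaledOrbitPoly_monic_and_natDegree hd (A : R) a' k
  have hQ := scaledOrbitPoly_monic_and_natDegree hd (A : R) b' k
  have hPe := aeval_scaledOrbitPoly (F := F) (d := d) (A := (A : R)) (c := a') (a := a)
    (t := t) (by simp [a']) (k + 1)
  have hQe := aeval_scaledOrbitPoly (F := F) (d := d) (A := (A : R)) (c := b') (a := b)
    (t := t) (by simp [b']) (k + 1)
  rw [map_natCast] at hPe hQe
  have hlead := leadingCoeff_sub_C_mul_of_monic hP.1 hQ.1 (hP.2.trans hQ.2.symm) hζ1'
  obtain ⟨μ, hμ⟩ := one_sub_dvd_prime_of_pow_prime_pow_eq_one (p := p) (j := k₀) (ζ := ζ')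
    (Subtype.ext (by simpa [ζ', ← hdp] using hζ)) hζ1'
  have hroot := isIntegral_leadingCoeff_smul (R := R) (S := F) _ ((A : F) ^ d * t) (by
    rw [map_sub, map_mul, aeval_C, hPe, hQe, h, show algebraMap R F ζ' = ζ from rfl]
    ring : aeval ((A : F) ^ d * t) (scaledOrbitPoly d (A : R) a' (k + 1) -
      C ζ' * scaledOrbitPoly d (A : R) b' (k + 1)) = 0)
  rw [hlead] at hroot
  have hμ' : (p : F) = (1 - ζ) * (μ : F) := by
    have := congrArg (algebraMap R F) hμ
    simpa using this
  have e : (p : F) * ((A : F) ^ d * t) = (μ : F) * ((1 - ζ') • ((A : F) ^ d * t)) := by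
    rw [hμ', Algebra.smul_def, show algebraMap R F (1 - ζ') = 1 - ζ from rfl]
    ring
  rw [e]
  exact μ.2.mul (isIntegral_trans (A := R) _ hroot)

end Integrality

/-! ### Archimedean estimates -/

section Archimedean

open Polynomial

theorem Polynomial.mahlerMeasure_le_of_norm_eval_le {P : ℂ[X]} {C : ℝ} (hC : 1 ≤ C)
    (h : ∀ z : ℂ, ‖z‖ = 1 → ‖P.eval z‖ ≤ C) : P.mahlerMeasure ≤ C := by
  by_cases hP : P = 0
  · simp only [hP, mahlerMeasure_zero]
    linarith
  rw [← Real.log_le_log_iff (mahlerMeasure_pos_of_ne_zero hP) (by linarith),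
    ← logMahlerMeasure_eq_log_MahlerMeasure, logMahlerMeasure_def]
  refine Real.circleAverage_mono_on_of_le_circle ?_ fun z hz ↦ ?_
  · exact P.intervalIntegrable_mahlerMeasure
  · rcases (norm_nonneg (P.eval z)).eq_or_lt with h0 | h0
    · simp only [← h0, Real.log_zero]
      exact Real.log_nonneg hC
    · exact Real.log_le_log h0 (h z (by simpa using hz))

theorem Polynomial.prod_max_norm_le_mahlerMeasure_div {P : ℂ[X]} (hP : P ≠ 0) (U : Finset ℂ)
    (hU : ∀ r ∈ U, P.IsRoot r) :
    ∏ r ∈ U, max ‖r‖ 1 ≤ P.mahlerMeasure / ‖P.leadingCoeff‖ := by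
  have hl : 0 < ‖P.leadingCoeff‖ := by simpa using hP
  rw [mahlerMeasure_eq_leadingCoeff_mul_prod_roots, mul_div_cancel_left₀ _ hl.ne']
  have hle : U.val ≤ P.roots := (Multiset.le_iff_subset U.nodup).2 fun r hr ↦
    (mem_roots hP).2 (hU r hr)
  obtain ⟨V, hV⟩ := Multiset.le_iff_exists_add.1 hle
  rw [hV, Multiset.map_add, Multiset.prod_add]
  have e : ∏ r ∈ U, max ‖r‖ 1 = (U.val.map fun r ↦ max 1 ‖r‖).prod := by
    simp only [max_comm, Finset.prod]
  rw [e]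
  exact le_mul_of_one_le_right (Multiset.prod_map_nonneg fun _ _ ↦ by positivity)
    (Multiset.one_le_prod_map fun _ _ ↦ le_max_left ..)

theorem norm_iterate_le_of_norm_parameter_le_one {d : ℕ} (hd : 1 < d) {a t : ℂ} {B : ℝ}
    (hB : 2 ≤ B) (ha : ‖a‖ ≤ B - 1) (ht : ‖t‖ ≤ 1) (k : ℕ) :
    ‖(fun z : ℂ ↦ z ^ d + t)^[k] a‖ ≤ B ^ d ^ k - 1 := by
  induction k with
  | zero => simpa using ha
  | succ k ih =>
    rw [Function.iterate_succ_apply']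
    set M := B ^ d ^ k with hM
    have hM2 : 2 ≤ M := hB.trans (le_self_pow₀ (by linarith) (by positivity))
    obtain ⟨e, rfl⟩ : ∃ e, d = e + 1 := ⟨d - 1, by lia⟩
    have h1 : ‖(fun z : ℂ ↦ z ^ (e + 1) + t)^[k] a‖ ^ (e + 1) ≤ (M - 1) * M ^ e :=
      (pow_le_pow_left₀ (norm_nonneg _) ih _).trans (by
        rw [pow_succ']
        gcongr
        · linarith
        · linarith
        · linarith)
    have h2 : 2 ≤ M ^ e := hM2.trans (le_self_pow₀ (by linarith) (by lia))
    have h3 : B ^ (e + 1) ^ (k + 1) = M * M ^ e := by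
      rw [pow_succ (e + 1) k, pow_mul, ← hM, pow_succ']
    rw [h3]
    refine (norm_add_le _ _).trans ?_
    rw [norm_pow]
    linarith

theorem norm_iterate_le_of_large_parameter {d : ℕ} (hd : 1 < d) {b t : ℂ} (ht : 1 ≤ ‖t‖)
    (hb : ‖b‖ ^ d ≤ ‖t‖) (k : ℕ) :
    ‖(fun z : ℂ ↦ z ^ d + t)^[k + 1] b‖ ≤ (3 * ‖t‖) ^ d ^ k - ‖t‖ := by
  induction k with
  | zero =>
    have := norm_add_le (b ^ d) t
    rw [norm_pow] at this
    simp only [zero_add, Function.iterate_one, pow_zero, pow_one]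
    linarith
  | succ k ih =>
    rw [Function.iterate_succ_apply']
    set r := ‖t‖
    set M := (3 * r) ^ d ^ k with hM
    have hM3 : 3 * r ≤ M := le_self_pow₀ (by linarith) (by positivity)
    obtain ⟨e, rfl⟩ : ∃ e, d = e + 1 := ⟨d - 1, by lia⟩
    have h1 : ‖(fun z : ℂ ↦ z ^ (e + 1) + t)^[k + 1] b‖ ^ (e + 1) ≤ (M - r) * M ^ e :=
      (pow_le_pow_left₀ (norm_nonneg _) ih _).trans (by
        rw [pow_succ']
        gcongr
        · linarith
        · linarith
        · linarith)
    have h2 : 2 ≤ M ^ e := (by linarith : 2 ≤ M).trans (le_self_pow₀ (by linarith) (by lia))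
    have h3 : (3 * r) ^ (e + 1) ^ (k + 1) = M * M ^ e := by
      rw [pow_succ (e + 1) k, pow_mul, ← hM, pow_succ']
    rw [h3]
    refine (norm_add_le _ _).trans ?_
    rw [norm_pow]
    nlinarith

theorem le_norm_iterate_of_large_parameter {d : ℕ} (hd : 1 < d) {a t : ℂ} (ht : 8 ≤ ‖t‖)
    (ha : 2 * ‖a‖ ^ d ≤ ‖t‖) (k : ℕ) :
    2 * (‖t‖ / 4) ^ d ^ k ≤ ‖(fun z : ℂ ↦ z ^ d + t)^[k + 1] a‖ := by
  induction k with
  | zero =>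
    have := norm_sub_le (a ^ d + t) (a ^ d)
    rw [add_sub_cancel_left, norm_pow] at this
    simp only [zero_add, Function.iterate_one, pow_zero, pow_one]
    linarith
  | succ k ih =>
    rw [Function.iterate_succ_apply']
    set r := ‖t‖
    set M := (r / 4) ^ d ^ k with hM
    have hMr : r / 4 ≤ M := le_self_pow₀ (by linarith) (by positivity)
    have h1 : (2 * M) ^ d ≤ ‖(fun z : ℂ ↦ z ^ d + t)^[k + 1] a‖ ^ d :=
      pow_le_pow_left₀ (by linarith) ih _
    have h2 : M ^ 2 ≤ M ^ d := pow_le_pow_right₀ (by linarith) hd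
    have h4 : (2 : ℝ) ^ 2 ≤ 2 ^ d := pow_le_pow_right₀ (by norm_num) hd
    have h3 : (r / 4) ^ d ^ (k + 1) = M ^ d := by rw [pow_succ d k, pow_mul, ← hM]
    rw [h3]
    rw [mul_pow] at h1
    have h5 := norm_sub_le (((fun z : ℂ ↦ z ^ d + t)^[k + 1] a) ^ d + t) t
    rw [add_sub_cancel_right, norm_pow] at h5
    have h6 : r ≤ 2 * M ^ 2 := by nlinarith
    have h7 : 0 ≤ M ^ d := by positivity
    have h8 : 4 * M ^ d ≤ 2 ^ d * M ^ d := mul_le_mul_of_nonneg_right (by linarith) h7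
    linarith

theorem norm_parameter_le_of_lt {d : ℕ} (hd : 1 < d) {a b t : ℂ} {B : ℝ}
    (ha : ‖a‖ ≤ B) (hb : ‖b‖ ≤ B) {m n : ℕ} (hnm : n < m)
    (h : (fun z : ℂ ↦ z ^ d + t)^[m + 1] a = (fun z : ℂ ↦ z ^ d + t)^[n + 1] b) :
    ‖t‖ ≤ 48 + 2 * B ^ d := by
  by_contra! hlt
  have hB0 : 0 ≤ B := (norm_nonneg _).trans ha
  have hBd : 0 ≤ B ^ d := by positivity
  have ha' : ‖a‖ ^ d ≤ B ^ d := pow_le_pow_left₀ (norm_nonneg _) ha d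
  have hb' : ‖b‖ ^ d ≤ B ^ d := pow_le_pow_left₀ (norm_nonneg _) hb d
  have hlow := le_norm_iterate_of_large_parameter hd (a := a) (t := t) (by linarith) (by linarith) m
  have hup := norm_iterate_le_of_large_parameter hd (b := b) (t := t) (by linarith) (by linarith) n
  rw [h] at hlow
  have h1 : (3 * ‖t‖) ^ d ^ n ≤ (‖t‖ / 4) ^ d ^ m := calc
    (3 * ‖t‖) ^ d ^ n ≤ ((‖t‖ / 4) ^ d) ^ d ^ n := by
      refine pow_le_pow_left₀ (by positivity) ?_ _
      have : (‖t‖ / 4) ^ 2 ≤ (‖t‖ / 4) ^ d := pow_le_pow_right₀ (by linarith) hd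
      nlinarith
    _ = (‖t‖ / 4) ^ d ^ (n + 1) := by rw [← pow_mul, ← pow_succ']
    _ ≤ (‖t‖ / 4) ^ d ^ m :=
      pow_le_pow_right₀ (by linarith) (Nat.pow_le_pow_right (by lia) hnm)
  have h2 : 0 ≤ (3 * ‖t‖) ^ d ^ n := by positivity
  linarith

/-- The parameters at which the `k + 1`-st iterates of `a` and `b` differ by a prescribed root of
unity are, on average, not large. -/
theorem prod_max_norm_parameter_le {d : ℕ} (hd : 1 < d) {B : ℝ} (hB : 2 ≤ B)
    (S : Finset (ℂ × ℂ × ℂ))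
    (hS : ∀ s ∈ S, ‖s.1‖ ≤ B - 1 ∧ ‖s.2.1‖ ≤ B - 1 ∧ ‖s.2.2‖ = 1 ∧ s.2.2 ≠ 1)
    {k : ℕ} (T : Finset ℂ)
    (hT : ∀ r ∈ T, ∃ s ∈ S, (fun z : ℂ ↦ z ^ d + r)^[k + 1] s.1 =
      s.2.2 * (fun z : ℂ ↦ z ^ d + r)^[k + 1] s.2.1) :
    ∏ r ∈ T, max ‖r‖ 1 ≤ ∏ s ∈ S, (2 / ‖1 - s.2.2‖ * B ^ d ^ (k + 1)) := by
  classical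
  choose! f hfS hf using hT
  rw [← Finset.prod_fiberwise_of_maps_to (g := f) (t := S) hfS]
  refine Finset.prod_le_prod (fun s _ ↦ Finset.prod_nonneg fun _ _ ↦ by positivity) fun s hs ↦ ?_
  obtain ⟨h1, h2, h3, h4⟩ := hS s hs
  have hP := scaledOrbitPoly_monic_and_natDegree hd (1 : ℂ) s.1 k
  have hQ := scaledOrbitPoly_monic_and_natDegree hd (1 : ℂ) s.2.1 k
  have hlead := leadingCoeff_sub_C_mul_of_monic hP.1 hQ.1 (hP.2.trans hQ.2.symm) h4
  have heval : ∀ r c : ℂ, (scaledOrbitPoly d 1 c (k + 1)).eval r =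
      (fun z : ℂ ↦ z ^ d + r)^[k + 1] c := fun r c ↦ by
    simpa using aeval_scaledOrbitPoly (R := ℂ) (F := ℂ) (d := d) (A := 1) (c := c) (a := c)
      (t := r) (by simp) (k + 1)
  set P := scaledOrbitPoly d 1 s.1 (k + 1) - C s.2.2 * scaledOrbitPoly d 1 s.2.1 (k + 1)
  have hne : (1 - s.2.2 : ℂ) ≠ 0 := sub_ne_zero.2 h4.symm
  have hP0 : P ≠ 0 := by
    rw [← leadingCoeff_ne_zero, hlead]
    exact hne
  have hB1 : 1 ≤ B ^ d ^ (k + 1) := one_le_pow₀ (by linarith)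
  refine (prod_max_norm_le_mahlerMeasure_div hP0 _ fun r hr ↦ ?_).trans ?_
  · obtain ⟨hrT, rfl⟩ := Finset.mem_filter.1 hr
    rw [IsRoot.def, eval_sub, eval_mul, eval_C, heval, heval, hf r hrT, sub_self]
  · rw [hlead, div_mul_eq_mul_div]
    gcongr
    refine mahlerMeasure_le_of_norm_eval_le (by linarith) fun z hz ↦ ?_
    rw [eval_sub, eval_mul, eval_C, heval, heval]
    refine (norm_sub_le _ _).trans ?_
    rw [norm_mul, h3, one_mul]
    have := norm_iterate_le_of_norm_parameter_le_one hd hB h1 hz.le (k + 1)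
    have := norm_iterate_le_of_norm_parameter_le_one hd hB h2 hz.le (k + 1)
    linarith

end Archimedean

/-! ### Heights of collision parameters -/

section Heights

open Polynomial IntermediateField NumberField

variable {F : Type*} [Field F] [CharZero F] [Algebra.IsAlgebraic ℚ F]

theorem exists_natCast_mul_isIntegral (a b : F) :
    ∃ A : ℕ, A ≠ 0 ∧ IsIntegral ℤ ((A : F) * a) ∧ IsIntegral ℤ ((A : F) * b) := by
  have key : ∀ x : F, ∃ A : ℕ, A ≠ 0 ∧ IsIntegral ℤ ((A : F) * x) := by
    intro x
    obtain ⟨y, hy, hint⟩ := ((IsFractionRing.isAlgebraic_iff ℤ ℚ F).2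
      (Algebra.IsAlgebraic.isAlgebraic (R := ℚ) x)).exists_integral_multiple
    refine ⟨y.natAbs, Int.natAbs_ne_zero.2 hy, ?_⟩
    rw [zsmul_eq_mul] at hint
    rcases Int.natAbs_eq y with h | h
    · rw [h] at hint
      simpa using hint
    · rw [h] at hint
      simpa using hint.neg
  obtain ⟨A, hA, hAa⟩ := key a
  obtain ⟨B, hB, hBb⟩ := key b
  have hN : ∀ n : ℕ, IsIntegral ℤ (n : F) := fun n ↦ by
    simpa using isIntegral_algebraMap (R := ℤ) (A := F) (x := (n : ℤ))
  refine ⟨A * B, mul_ne_zero hA hB, ?_, ?_⟩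
  · simpa [mul_comm, mul_left_comm, mul_assoc] using (hN B).mul hAa
  · simpa [mul_comm, mul_left_comm, mul_assoc] using (hN A).mul hBb

theorem exists_ringHom_extending_adjoin_gen (t : F) (φ : ℚ⟮t⟯ →+* ℂ) :
    ∃ ψ : F →+* ℂ, ψ t = φ (AdjoinSimple.gen ℚ t) := by
  let _ := φ.toAlgebra
  have : Algebra.IsAlgebraic ℚ⟮t⟯ F := Algebra.IsAlgebraic.tower_top (K := ℚ) _
  let ψ : F →ₐ[ℚ⟮t⟯] ℂ := IsAlgClosed.lift
  refine ⟨ψ, ?_⟩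
  exact ψ.commutes (AdjoinSimple.gen ℚ t)

theorem apply_mem_aroots_minpoly (x : F) (ψ : F →+* ℂ) : ψ x ∈ (minpoly ℚ x).aroots ℂ := by
  have hx : IsIntegral ℚ x := Algebra.IsIntegral.isIntegral x
  refine mem_aroots.2 ⟨minpoly.ne_zero hx, ?_⟩
  rw [aeval_def, show algebraMap ℚ ℂ = ψ.comp (algebraMap ℚ F) from RingHom.ext_rat _ _,
    ← hom_eval₂, ← aeval_def, minpoly.aeval, map_zero]

theorem exists_norm_apply_le (x : F) : ∃ B : ℝ, ∀ ψ : F →+* ℂ, ‖ψ x‖ ≤ B := by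
  classical
  exact ⟨∑ z ∈ ((minpoly ℚ x).aroots ℂ).toFinset, ‖z‖, fun ψ ↦
    Finset.single_le_sum (f := fun z ↦ ‖z‖) (fun _ _ ↦ norm_nonneg _)
      (Multiset.mem_toFinset.2 (apply_mem_aroots_minpoly x ψ))⟩

theorem map_iterate_pow_add {F K : Type*} [Field F] [Field K] (ψ : F →+* K) (d : ℕ) (a t : F)
    (k : ℕ) :
    ψ ((fun z : F ↦ z ^ d + t)^[k] a) = (fun z : K ↦ z ^ d + ψ t)^[k] (ψ a) :=
  Function.Semiconj.iterate_right (f := ψ) (fun z ↦ by simp) k a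

/-- Collisions of orbits at different times happen at parameters of bounded height. -/
theorem exists_absLogHeight₁_le_of_lt {d : ℕ} (hd : 1 < d) (a b : F) :
    ∃ C : ℝ, ∀ (t : F) (m n : ℕ), n < m →
      (fun z : F ↦ z ^ d + t)^[m + 1] a = (fun z : F ↦ z ^ d + t)^[n + 1] b →
      absLogHeight₁ t ≤ C := by
  obtain ⟨A, hA, hAa, hAb⟩ := exists_natCast_mul_isIntegral a b
  obtain ⟨B₁, hB₁⟩ := exists_norm_apply_le a
  obtain ⟨B₂, hB₂⟩ := exists_norm_apply_le b
  set B := max (max B₁ B₂) 0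
  have hB0 : 0 ≤ B := le_max_right ..
  have hC1 : 1 ≤ 48 + 2 * B ^ d := by linarith [pow_nonneg hB0 d]
  refine ⟨Real.log ((A ^ d : ℕ) * (48 + 2 * B ^ d)), fun t m n hnm h ↦ ?_⟩
  have ht : IsIntegral ℚ t := Algebra.IsIntegral.isIntegral t
  have : FiniteDimensional ℚ ℚ⟮t⟯ := adjoin.finiteDimensional ht
  have : NumberField ℚ⟮t⟯ := {}
  refine absLogHeight₁_le_of_isIntegral_natCast_mul ht (pow_ne_zero d hA) ?_ (fun s ↦ ?_)
    (by linarith)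
  · rw [Nat.cast_pow]
    exact isIntegral_parameter_of_lt hd hAa hAb hnm h
  · have hle : ∀ φ ∈ s, max ‖φ (AdjoinSimple.gen ℚ t)‖ 1 ≤ 48 + 2 * B ^ d := fun φ _ ↦ by
      obtain ⟨ψ, hψ⟩ := exists_ringHom_extending_adjoin_gen t φ
      rw [← hψ]
      refine max_le (norm_parameter_le_of_lt hd (B := B) (a := ψ a) (b := ψ b)
        ((hB₁ ψ).trans (by simp [B])) ((hB₂ ψ).trans (by simp [B])) hnm ?_) hC1
      rw [← map_iterate_pow_add, ← map_iterate_pow_add, h]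
    have hcard : s.card ≤ (minpoly ℚ t).natDegree := by
      rw [← adjoin.finrank ht, ← Embeddings.card ℚ⟮t⟯ ℂ]
      exact Finset.card_le_univ s
    calc _ ≤ (48 + 2 * B ^ d) ^ s.card :=
          (Finset.prod_le_prod (fun _ _ ↦ by positivity) hle).trans_eq (Finset.prod_const _)
      _ ≤ _ := pow_le_pow_right₀ hC1 hcard

/-- Parameters of large degree at which two iterates of `a` and `b` differ by a nontrivial
root of unity of prime power order are of bounded height. -/
theorem exists_absLogHeight₁_le_of_root_of_unity {p : ℕ} [hp : Fact p.Prime] {k₀ d : ℕ}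
    (hd : 1 < d) (hdp : d = p ^ k₀) (a b : F) :
    ∃ C : ℝ, ∀ (t ζ : F) (k : ℕ), ζ ^ d = 1 → ζ ≠ 1 →
      (fun z : F ↦ z ^ d + t)^[k + 1] a = ζ * (fun z : F ↦ z ^ d + t)^[k + 1] b →
      d ^ k ≤ (minpoly ℚ t).natDegree → absLogHeight₁ t ≤ C := by
  classical
  obtain ⟨A, hA, hAa, hAb⟩ := exists_natCast_mul_isIntegral a b
  obtain ⟨B₁, hB₁⟩ := exists_norm_apply_le a
  obtain ⟨B₂, hB₂⟩ := exists_norm_apply_le b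
  set B := max (max B₁ B₂) 1 + 1 with hB
  have hB2 : 2 ≤ B := by linarith [le_max_right (max B₁ B₂) 1]
  have hB₁' : ∀ ψ : F →+* ℂ, ‖ψ a‖ ≤ B - 1 := fun ψ ↦ (hB₁ ψ).trans (by simp [hB])
  have hB₂' : ∀ ψ : F →+* ℂ, ‖ψ b‖ ≤ B - 1 := fun ψ ↦ (hB₂ ψ).trans (by simp [hB])
  let S : Finset (ℂ × ℂ × ℂ) := (((minpoly ℚ a).aroots ℂ).toFinset ×ˢ
    ((minpoly ℚ b).aroots ℂ).toFinset ×ˢ (nthRoots d (1 : ℂ)).toFinset).filter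
      fun s ↦ ‖s.1‖ ≤ B - 1 ∧ ‖s.2.1‖ ≤ B - 1 ∧ ‖s.2.2‖ = 1 ∧ s.2.2 ≠ 1
  have hS : ∀ s ∈ S, ‖s.1‖ ≤ B - 1 ∧ ‖s.2.1‖ ≤ B - 1 ∧ ‖s.2.2‖ = 1 ∧ s.2.2 ≠ 1 :=
    fun s hs ↦ (Finset.mem_filter.1 hs).2
  set Q := max (∏ s ∈ S, 2 / ‖1 - s.2.2‖) 1
  have hQ1 : 1 ≤ Q := le_max_right ..
  have hBS : 1 ≤ (B ^ d) ^ S.card := one_le_pow₀ (one_le_pow₀ (by linarith))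
  refine ⟨Real.log ((p * A ^ d : ℕ) * (Q * (B ^ d) ^ S.card)), fun t ζ k hζ hζ1 h hdeg ↦ ?_⟩
  have ht : IsIntegral ℚ t := Algebra.IsIntegral.isIntegral t
  have : FiniteDimensional ℚ ℚ⟮t⟯ := adjoin.finiteDimensional ht
  have : NumberField ℚ⟮t⟯ := {}
  refine absLogHeight₁_le_of_isIntegral_natCast_mul ht
    (mul_ne_zero hp.out.ne_zero (pow_ne_zero d hA)) ?_ (fun s ↦ ?_) (by positivity)
  · have := isIntegral_parameter_of_root_of_unity hd hdp hAa hAb hζ hζ1 h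
    rw [← mul_assoc] at this
    exact_mod_cast this
  have hinj : Set.InjOn (fun φ : ℚ⟮t⟯ →+* ℂ ↦ φ (AdjoinSimple.gen ℚ t)) s := fun φ _ φ' _ hφ ↦ by
    have : φ.toRatAlgHom = φ'.toRatAlgHom := IntermediateField.adjoin_algHom_ext ℚ fun x hx ↦ by
      obtain rfl : x = t := hx
      exact hφ
    exact RingHom.ext fun x ↦ DFunLike.congr_fun this x
  have hprod := prod_max_norm_parameter_le hd hB2 S hS (k := k)
    (s.image fun φ ↦ φ (AdjoinSimple.gen ℚ t)) (fun r hr ↦ by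
      obtain ⟨φ, -, rfl⟩ := Finset.mem_image.1 hr
      obtain ⟨ψ, hψ⟩ := exists_ringHom_extending_adjoin_gen t φ
      have hψζ : ψ ζ ^ d = 1 := by rw [← map_pow, hζ, map_one]
      refine ⟨(ψ a, ψ b, ψ ζ), Finset.mem_filter.2 ⟨?_, hB₁' ψ, hB₂' ψ, ?_, ?_⟩, ?_⟩
      · simp only [Finset.mem_product, Multiset.mem_toFinset, mem_nthRoots (by lia : 0 < d)]
        exact ⟨apply_mem_aroots_minpoly a ψ, apply_mem_aroots_minpoly b ψ, hψζ⟩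
      · exact Complex.norm_eq_one_of_pow_eq_one hψζ (by lia)
      · exact fun h' ↦ hζ1 (ψ.injective (h'.trans (map_one ψ).symm))
      · simp only [← hψ]
        rw [← map_iterate_pow_add, ← map_iterate_pow_add, h, map_mul])
  rw [Finset.prod_image hinj] at hprod
  refine hprod.trans ?_
  rw [Finset.prod_mul_distrib, Finset.prod_const, mul_pow]
  set D := (minpoly ℚ t).natDegree
  have hD : D ≠ 0 := (minpoly.natDegree_pos ht).ne'
  gcongr
  · exact (le_max_left _ _).trans (le_self_pow₀ hQ1 hD)
  · rw [← pow_mul, ← pow_mul, ← pow_mul, pow_succ, mul_assoc, mul_comm (d ^ k)]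
    exact pow_le_pow_right₀ (by linarith) (by
      rw [mul_assoc]
      exact Nat.mul_le_mul_left _ (Nat.mul_le_mul_left _ hdeg))

end Heights

theorem PadicInt.norm_algebraMap_sub_eq_one {p : ℕ} [Fact p.Prime] {α β : ℤ_[p]}
    (hα : IsUnit α) (hβ : (p : ℤ_[p]) ∣ β) :
    ‖algebraMap ℚ_[p] (PadicAlgCl p) α - algebraMap ℚ_[p] (PadicAlgCl p) β‖ = 1 := by
  have h1 : ‖(α : ℚ_[p])‖ = 1 := PadicInt.isUnit_iff.1 hα
  have h2 : ‖(β : ℚ_[p])‖ < 1 := (PadicInt.norm_lt_one_iff_dvd β).2 hβ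
  rw [← map_sub, PadicAlgCl.norm_extends, sub_eq_add_neg, norm_add_eq_left_of_lt, h1]
  rwa [norm_neg, h1]

theorem mainTheorem6 (p : ℕ) [Fact p.Prime] (d : ℕ) (hd : 1 < d) (hdp : ∃ k : ℕ, d = p ^ k)
    (σ : AlgebraicClosure ℚ →+* AlgebraicClosure ℚ_[p])
    (a b : AlgebraicClosure ℚ) (α β : ℤ_[p])
    (ha : σ a = algebraMap ℚ_[p] (AlgebraicClosure ℚ_[p]) (α : ℚ_[p]))
    (hb : σ b = algebraMap ℚ_[p] (AlgebraicClosure ℚ_[p]) (β : ℚ_[p]))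
    (hab : (IsUnit α ∧ (p : ℤ_[p]) ∣ β) ∨ ((p : ℤ_[p]) ∣ α ∧ IsUnit β)) :
    BddAbove (NumberField.absLogHeight₁ '' {t : AlgebraicClosure ℚ |
      ∃ m n : ℕ, 0 < m ∧ 0 < n ∧
        (fun z : AlgebraicClosure ℚ => z ^ d + t)^[m] a =
          (fun z : AlgebraicClosure ℚ => z ^ d + t)^[n] b}) := by
  obtain ⟨k₀, hk₀⟩ := hdp
  have halg : Algebra.IsAlgebraic ℚ (AlgebraicClosure ℚ) := by
    rw [show (DivisionRing.toRatAlgebra : Algebra ℚ (AlgebraicClosure ℚ)) =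
      AlgebraicClosure.instAlgebra ℚ from Subsingleton.elim _ _]
    exact AlgebraicClosure.isAlgebraic ℚ
  have hp0 : 0 < ‖(p : PadicAlgCl p)‖ := by
    rw [norm_pos_iff]
    exact_mod_cast (Fact.out : p.Prime).ne_zero
  have hp1 : ‖(p : PadicAlgCl p)‖ < 1 := by
    rw [← map_natCast (algebraMap ℚ_[p] (PadicAlgCl p)), PadicAlgCl.norm_extends]
    exact Padic.norm_p_lt_one
  have h0 : ‖σ a - σ b‖ = 1 := by
    rw [ha, hb]
    rcases hab with ⟨h1, h2⟩ | ⟨h1, h2⟩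
    · exact PadicInt.norm_algebraMap_sub_eq_one h1 h2
    · rw [norm_sub_rev]
      exact PadicInt.norm_algebraMap_sub_eq_one h2 h1
  have ha1 : ‖σ a‖ ≤ 1 := by
    rw [ha, PadicAlgCl.norm_extends]
    exact α.2
  have hb1 : ‖σ b‖ ≤ 1 := by
    rw [hb, PadicAlgCl.norm_extends]
    exact β.2
  have hk₀0 : k₀ ≠ 0 := by
    rintro rfl
    simp [hk₀] at hd
  obtain ⟨C₁, hC₁⟩ := exists_absLogHeight₁_le_of_lt hd a b
  obtain ⟨C₂, hC₂⟩ := exists_absLogHeight₁_le_of_lt hd b a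
  obtain ⟨C₃, hC₃⟩ := exists_absLogHeight₁_le_of_root_of_unity hd hk₀ a b
  refine ⟨max (max C₁ C₂) C₃, ?_⟩
  rintro _ ⟨t, ⟨m, n, hm, hn, h⟩, rfl⟩
  obtain ⟨m, rfl⟩ := Nat.exists_eq_add_one.2 hm
  obtain ⟨n, rfl⟩ := Nat.exists_eq_add_one.2 hn
  rcases lt_trichotomy n m with hnm | rfl | hnm
  · exact (hC₁ t m n hnm h).trans (by simp)
  · refine le_trans ?_ (le_max_right _ _)
    have hsucc : ∀ (c : AlgebraicClosure ℚ) (j : ℕ),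
        (fun z : AlgebraicClosure ℚ => z ^ d + t)^[j + 1] c =
          ((fun z : AlgebraicClosure ℚ => z ^ d + t)^[j] c) ^ d + t := fun c j ↦
      Function.iterate_succ_apply' _ _ _
    set X : ℕ → AlgebraicClosure ℚ := fun j ↦ (fun z : AlgebraicClosure ℚ => z ^ d + t)^[j] a
    set Y : ℕ → AlgebraicClosure ℚ := fun j ↦ (fun z : AlgebraicClosure ℚ => z ^ d + t)^[j] b
    have hX : ∀ j, σ (X (j + 1)) = σ (X j) ^ p ^ k₀ + σ t := fun j ↦ by
      rw [show X (j + 1) = X j ^ d + t from hsucc a j, map_add, map_pow, hk₀]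
    have hY : ∀ j, σ (Y (j + 1)) = σ (Y j) ^ p ^ k₀ + σ t := fun j ↦ by
      rw [show Y (j + 1) = Y j ^ d + t from hsucc b j, map_add, map_pow, hk₀]
    have hne0 : X 0 ≠ Y 0 := fun h' ↦ by
      rw [show a = b from h', sub_self, norm_zero] at h0
      exact zero_ne_one h0
    have hne1 : X 1 ≠ Y 1 := fun h' ↦ by
      have h1 : a ^ d = b ^ d := by
        have := (hsucc a 0).symm.trans (h'.trans (hsucc b 0))
        exact add_right_cancel this
      have h2 := norm_add_pow_prime_pow_sub_le (p := p) k₀ h0.le hb1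
      rw [sub_add_cancel, ← hk₀, ← map_pow, ← map_pow, h1, sub_right_comm, sub_self, zero_sub,
        norm_neg, norm_pow, h0, one_pow, mul_one] at h2
      exact absurd hp1 h2.not_gt
    obtain ⟨k, hk, hk'⟩ : ∃ k, X (k + 1) ≠ Y (k + 1) ∧ X (k + 2) = Y (k + 2) := by
      by_contra! hcon
      have : ∀ j, X (j + 1) ≠ Y (j + 1) := fun j ↦ by
        induction j with
        | zero => exact hne1
        | succ j ih => exact hcon j ih
      exact this n h
    have hpow : X (k + 1) ^ d = Y (k + 1) ^ d :=
      add_right_cancel ((hsucc a (k + 1)).symm.trans (hk'.trans (hsucc b (k + 1))))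
    have hYne : Y (k + 1) ≠ 0 := fun h' ↦ hk (by
      rw [h', zero_pow (by lia)] at hpow
      rw [h', eq_zero_of_pow_eq_zero hpow])
    obtain ⟨hτ1, hτ2⟩ := norm_parameter_of_collision hp0 hp1 hk₀0
      (X := fun j ↦ σ (X j)) (Y := fun j ↦ σ (Y j)) hX hY ha1 hb1 h0 k
      (fun h' ↦ hk (σ.injective h')) (congrArg σ hk')
    refine hC₃ t (X (k + 1) / Y (k + 1)) k ?_ ?_ (div_mul_cancel₀ _ hYne).symm ?_
    · rw [div_pow, hpow, div_self (pow_ne_zero _ hYne)]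
    · rwa [Ne, div_eq_one_iff_eq hYne]
    · rw [hk₀]
      exact le_natDegree_minpoly_rat σ (Algebra.IsIntegral.isIntegral t) hτ1 hτ2
  · exact (hC₂ t n m hnm h.symm).trans (by simp)
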